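/- Let $\mathcal{C}^2$ be the space of continuous maps $f\colon [0,1]\to\mathbb{R}^2$ endowed with the supremum metric (a complete metric space), and write $\operatorname{ran}(f)=f([0,1])$. A set $K\subseteq\mathbb{R}^2$ is said to separate two points $p,q\in\mathbb{R}^2\setminus K$ if $p$ and $q$ belong to different connected components of $\mathbb{R}^2\setminus K$; a continuum is a compact connected set. Then the following holds for the generic $f\in\mathcal{C}^2$, that is, for all $f$ in a co-meager subset of $\mathcal{C}^2$: for all $p,q\in\mathbb{R}^2\setminus\operatorname{ran}(f)$ such that $\operatorname{ran}(f)$ separates $p$ and $q$, and for every continuum $C\subseteq\mathbb{R}^2$ with $p,q\in C$, the intersection $C\cap\operatorname{ran}(f)$ has cardinality continuum (that is, $2^{\aleph_0}$). -/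

import Mathlib

/-- The Euclidean plane `ℝ²`. -/
abbrev Plane : Type := EuclideanSpace ℝ (Fin 2)

/-- The space of plane curves, i.e. of continuous maps `[0,1] → ℝ²`. Since `[0,1]` is compact,
the topology is the one of the (complete) supremum metric. -/
abbrev PlaneCurve : Type := C(unitInterval, Plane)

/-- A subset `K` of the plane separates the points `p` and `q` if both lie outside `K`, and they
belong to different connected components of the complement of `K`. -/
def SeparatesInPlane (K : Set Plane) (p q : Plane) : Prop :=
  p ∉ K ∧ q ∉ K ∧ connectedComponentIn Kᶜ p ≠ connectedComponentIn Kᶜ q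

/-- A continuum in the plane: a compact connected set. -/
def IsPlaneContinuum (C : Set Plane) : Prop :=
  IsCompact C ∧ IsConnected C

/-!
The proof shows that for the generic curve `f`, distinct components of the complement of `ran f`
have disjoint closures (`eventually_residual_disjoint_closure`). Sierpiński's theorem
(`exists_subset_of_countable_closed_cover`) then finishes the argument: if a continuum `C` met
`ran f` in a countable set, it would be covered by countably many pairwise disjoint closed sets, the
closures of the complementary components and the singletons of the remaining points of
`C ∩ ran f`. So it would lie in the closure of a single component, and could not contain two points
that `ran f` separates. Hence `C ∩ ran f` is an uncountable closed set, of cardinality continuum.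

The disjointness of closures rests on two facts. If `x` is a common boundary point of the components
of `p` and `q`, then no subset of `ran f` that misses `x` separates `p` and `q`
(`connectedComponentIn_compl_eq_of_mem_closure`). On the other hand, near every curve `f₀` there is
an open set of curves whose ranges contain the ranges of three curves near `f₀` without a common
point (`exists_near_forall_near_exists_three_curves`). If every curve near `f₀` that misses `p` and
`q` separates them, then so do these three, and one of them misses `x`; otherwise some curve near
`f₀` leaves `p` and `q` in the same component, and so do all curves close to it.

The three curves follow `f₀` along crosses on three mutually shifted square grids. A point lies near
at most two of the grids, as it has only two coordinates. The crosses are visited in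
disjoint time intervals and overlap so much that consecutive ones still meet after a small
perturbation, by the crossing property of paths in the plane (`exists_eq_of_crossing`), which is
proved by lifting the difference of the two paths along the complex exponential.
-/

/-! ### Crossing paths -/

/-- A continuous real function on `[0,1]` at whose values the sine is positive stays in one of the
intervals of length `π` on which the sine is positive. -/
lemma exists_int_forall_mem_Ioo_of_sin_pos {φ : unitInterval → ℝ} (hφ : Continuous φ)
    (h : ∀ u, 0 < Real.sin (φ u)) :
    ∃ k : ℤ, ∀ u, 2 * Real.pi * k < φ u ∧ φ u < 2 * Real.pi * k + Real.pi := by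
  have hpi := Real.pi_pos
  refine ⟨⌊φ 0 / (2 * Real.pi)⌋, fun u ↦ ?_⟩
  set k := ⌊φ 0 / (2 * Real.pi)⌋
  have h1 : 2 * Real.pi * k ≤ φ 0 := by
    have := Int.floor_le (φ 0 / (2 * Real.pi))
    rw [le_div_iff₀ (by positivity)] at this
    linarith
  have h2 : φ 0 < 2 * Real.pi * k + 2 * Real.pi := by
    have := Int.lt_floor_add_one (φ 0 / (2 * Real.pi))
    rw [div_lt_iff₀ (by positivity)] at this
    linarith
  have hs (x : ℝ) : Real.sin (2 * Real.pi * k + x) = Real.sin x := by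
    rw [add_comm, mul_comm, Real.sin_add_int_mul_two_pi]
  -- in the second half of the period, the sine is not positive
  have h3 : φ 0 < 2 * Real.pi * k + Real.pi := by
    by_contra! hc
    have h4 := h 0
    rw [show φ 0 = 2 * Real.pi * k + (φ 0 - 2 * Real.pi * k) by ring, hs,
      show φ 0 - 2 * Real.pi * k = (φ 0 - 2 * Real.pi * k - Real.pi) + Real.pi by ring,
      Real.sin_add_pi] at h4
    have := Real.sin_nonneg_of_nonneg_of_le_pi
      (x := φ 0 - 2 * Real.pi * k - Real.pi) (by linarith) (by linarith)
    linarith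
  constructor
  · by_contra! hc
    obtain ⟨v, hv⟩ := mem_range_of_exists_le_of_exists_ge hφ ⟨u, hc⟩ ⟨0, h1⟩
    have := h v
    rw [hv, ← add_zero (2 * Real.pi * k), hs] at this
    simp at this
  · by_contra! hc
    obtain ⟨v, hv⟩ := mem_range_of_exists_le_of_exists_ge hφ ⟨0, h3.le⟩ ⟨u, hc⟩
    have := h v
    rw [hv, hs] at this
    simp at this

/-- A path that runs from the left of a second path to its right, while the second runs from below
the first to above it, meets the second. Otherwise the difference of the two paths has a continuous
logarithm on the square of parameters, whose imaginary part changes by `-2π` along the boundary. -/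
theorem exists_eq_of_crossing {a b : unitInterval → Plane} (ha : Continuous a) (hb : Continuous b)
    (hl : ∀ t, a 0 0 < b t 0) (hr : ∀ t, b t 0 < a 1 0)
    (hd : ∀ s, b 0 1 < a s 1) (hu : ∀ s, a s 1 < b 1 1) : ∃ s t, a s = b t := by
  by_contra! hne
  let P : ℝ → unitInterval := Set.projIcc 0 1 zero_le_one
  have hP : Continuous P := continuous_projIcc
  let F : ℝ × ℝ → ℂ := fun z ↦
    ((a (P z.1) 0 - b (P z.2) 0 : ℝ) : ℂ) + ((a (P z.1) 1 - b (P z.2) 1 : ℝ) : ℂ) * Complex.I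
  have hF : Continuous F := by fun_prop
  have hFre (z) : (F z).re = a (P z.1) 0 - b (P z.2) 0 := by simp [F]
  have hFim (z) : (F z).im = a (P z.1) 1 - b (P z.2) 1 := by simp [F]
  have hF0 : 0 ∉ F '' Set.univ := by
    rintro ⟨z, -, hz⟩
    have h0 := hFre z
    have h1 := hFim z
    rw [hz] at h0 h1
    apply hne (P z.1) (P z.2)
    ext i
    fin_cases i
    · simpa using (sub_eq_zero.1 h0.symm)
    · simpa using (sub_eq_zero.1 h1.symm)
  have hsc : IsSimplyConnected (Set.univ : Set (ℝ × ℝ)) := by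
    have := (convex_univ (𝕜 := ℝ) (E := ℝ × ℝ)).contractibleSpace Set.univ_nonempty
    exact SimplyConnectedSpace.ofContractible (Set.univ : Set (ℝ × ℝ))
  obtain ⟨L, hLc, hL⟩ := Complex.exists_continuousOn_eqOn_exp_comp hsc isOpen_univ
    hF.continuousOn hF0
  rw [continuousOn_univ] at hLc
  have hre (z) : Real.exp (L z).re * Real.cos (L z).im = a (P z.1) 0 - b (P z.2) 0 := by
    rw [← hFre, ← hL (Set.mem_univ z), Function.comp, Complex.exp_re]
  have him (z) : Real.exp (L z).re * Real.sin (L z).im = a (P z.1) 1 - b (P z.2) 1 := by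
    rw [← hFim, ← hL (Set.mem_univ z), Function.comp, Complex.exp_im]
  have hPv (u : unitInterval) : P u = u := Set.projIcc_val zero_le_one u
  have hP0 : P 0 = 0 := Set.projIcc_left zero_le_one
  have hP1 : P 1 = 1 := Set.projIcc_right zero_le_one
  have e (x : ℝ) := Real.exp_pos x
  obtain ⟨k₁, h₁⟩ := exists_int_forall_mem_Ioo_of_sin_pos
    (φ := fun u : unitInterval ↦ (L (u, 0)).im) (by fun_prop) fun u ↦ by
      have := him (u, 0)
      simp only [hP0, hPv] at this
      exact (mul_pos_iff_of_pos_left (e _)).1 (this ▸ sub_pos.2 (hd u))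
  obtain ⟨k₂, h₂⟩ := exists_int_forall_mem_Ioo_of_sin_pos
    (φ := fun u : unitInterval ↦ (L (1, u)).im + Real.pi / 2) (by fun_prop) fun u ↦ by
      have := hre (1, u)
      simp only [hP1, hPv] at this
      rw [Real.sin_add_pi_div_two]
      exact (mul_pos_iff_of_pos_left (e _)).1 (this ▸ sub_pos.2 (hr u))
  obtain ⟨k₃, h₃⟩ := exists_int_forall_mem_Ioo_of_sin_pos
    (φ := fun u : unitInterval ↦ (L (u, 1)).im + Real.pi) (by fun_prop) fun u ↦ by
      have := him (u, 1)
      simp only [hP1, hPv] at this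
      rw [Real.sin_add_pi]
      refine (mul_pos_iff_of_pos_left (e (L (u, 1)).re)).1 ?_
      rw [mul_neg, this]
      linarith [hu u]
  obtain ⟨k₄, h₄⟩ := exists_int_forall_mem_Ioo_of_sin_pos
    (φ := fun u : unitInterval ↦ (L (0, u)).im - Real.pi / 2) (by fun_prop) fun u ↦ by
      have := hre (0, u)
      simp only [hP0, hPv] at this
      rw [Real.sin_sub_pi_div_two]
      refine (mul_pos_iff_of_pos_left (e (L (0, u)).re)).1 ?_
      rw [mul_neg, this]
      linarith [hl u]
  have hpi := Real.pi_pos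
  have a₀ := h₁ 0
  have a₁ := h₁ 1
  have b₀ := h₂ 0
  have b₁ := h₂ 1
  have c₀ := h₃ 0
  have c₁ := h₃ 1
  have d₀ := h₄ 0
  have d₁ := h₄ 1
  simp only [Set.Icc.coe_zero, Set.Icc.coe_one] at a₀ a₁ b₀ b₁ c₀ c₁ d₀ d₁
  have key {m n : ℤ} {r : ℝ} (h : 2 * Real.pi * m < 2 * Real.pi * n + r * Real.pi) :
      (m : ℝ) < n + r / 2 := by
    have : 0 < 2 * Real.pi * (n + r / 2 - m) := by linarith
    linarith [(mul_pos_iff_of_pos_left (by positivity : 0 < 2 * Real.pi)).1 this]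
  -- comparison at the corners `(1,0)`, `(1,1)`, `(0,1)` and `(0,0)`
  have i₁ : k₂ < k₁ + 1 := by
    have := key (m := k₂) (n := k₁) (r := 3 / 2) (by linarith)
    exact_mod_cast (by linarith : (k₂ : ℝ) < k₁ + 1)
  have i₂ : k₃ < k₂ + 1 := by
    have := key (m := k₃) (n := k₂) (r := 3 / 2) (by linarith)
    exact_mod_cast (by linarith : (k₃ : ℝ) < k₂ + 1)
  have i₃ : k₄ < k₃ := by
    have := key (m := k₄) (n := k₃) (r := -1 / 2) (by linarith)
    exact_mod_cast (by linarith : (k₄ : ℝ) < k₃)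
  have i₄ : k₁ < k₄ + 1 := by
    have := key (m := k₁) (n := k₄) (r := 3 / 2) (by linarith)
    exact_mod_cast (by linarith : (k₁ : ℝ) < k₄ + 1)
  omega

/-! ### Continua and countable closed partitions -/

/-- Boundary bumping: in a continuum `C`, the component of a point in `C ∩ closure U` leaves the
open set `U`, unless `C` lies in `U`. Otherwise some clopen subset of `C ∩ closure U` would lie
in `U`, hence be clopen in `C`. -/
theorem exists_subcontinuum_not_subset {X : Type*} [TopologicalSpace X] [T2Space X] {C U : Set X}
    (hC : IsCompact C) (hconn : IsPreconnected C) (hU : IsOpen U) (hCU : ¬ C ⊆ U) {x : X}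
    (hxC : x ∈ C) (hxU : x ∈ U) :
    ∃ K ⊆ C ∩ closure U, IsCompact K ∧ IsPreconnected K ∧ x ∈ K ∧ ¬ K ⊆ U := by
  have hY : IsCompact (C ∩ closure U) := hC.inter_right isClosed_closure
  have hxY : x ∈ C ∩ closure U := ⟨hxC, subset_closure hxU⟩
  have : CompactSpace ↥(C ∩ closure U) := isCompact_iff_compactSpace.1 hY
  let K : Set ↥(C ∩ closure U) := connectedComponent ⟨x, hxY⟩
  have hKc : IsCompact K := isClosed_connectedComponent.isCompact
  refine ⟨(↑) '' K, Subtype.coe_image_subset _ _, hKc.image continuous_subtype_val,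
    isPreconnected_connectedComponent.image _ continuous_subtype_val.continuousOn,
    ⟨⟨x, hxY⟩, mem_connectedComponent, rfl⟩, fun hKU ↦ hCU ?_⟩
  have hsub : (⋂ s : {s : Set ↥(C ∩ closure U) // IsClopen s ∧ ⟨x, hxY⟩ ∈ s}, s.1) ⊆
      Subtype.val ⁻¹' U := by
    rw [← connectedComponent_eq_iInter_isClopen]
    exact Set.image_subset_iff.1 hKU
  have hdir : Directed (· ⊇ ·)
      fun s : {s : Set ↥(C ∩ closure U) // IsClopen s ∧ ⟨x, hxY⟩ ∈ s} ↦ s.1 :=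
    fun s t ↦ ⟨⟨s ∩ t, s.2.1.inter t.2.1, s.2.2, t.2.2⟩, Set.inter_subset_left,
      Set.inter_subset_right⟩
  have : Nonempty {s : Set ↥(C ∩ closure U) // IsClopen s ∧ ⟨x, hxY⟩ ∈ s} :=
    ⟨⟨Set.univ, isClopen_univ, trivial⟩⟩
  obtain ⟨⟨Z, hZ, hxZ⟩, hZU⟩ := exists_subset_nhds_of_isCompact hdir
    (fun s ↦ s.2.1.1.isCompact)
    (U := Subtype.val ⁻¹' U) (fun y hy ↦ (hU.preimage continuous_subtype_val).mem_nhds (hsub hy))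
  have hcl {s : Set ↥(C ∩ closure U)} (hs : IsClosed s) :
      IsClosed (((↑) : ↥(C ∩ closure U) → X) '' s) :=
    (hs.isCompact.image continuous_subtype_val).isClosed
  intro y hy
  by_contra hyU
  obtain ⟨z, hzC, ⟨w, hwZ, rfl⟩, hz⟩ := isPreconnected_closed_iff.1 hconn
    ((↑) '' Z) ((C \ U) ∪ (↑) '' Zᶜ) (hcl hZ.1)
    ((hC.isClosed.sdiff hU).union (hcl hZ.compl.1))
    (fun z hz ↦ by
      by_cases hzU : z ∈ U
      · by_cases hzZ : (⟨z, hz, subset_closure hzU⟩ : ↥(C ∩ closure U)) ∈ Z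
        · exact .inl ⟨_, hzZ, rfl⟩
        · exact .inr (.inr ⟨_, hzZ, rfl⟩)
      · exact .inr (.inl ⟨hz, hzU⟩))
    ⟨x, hxC, ⟨_, hxZ, rfl⟩⟩ ⟨y, hy, .inl ⟨hy, hyU⟩⟩
  rcases hz with hz | ⟨w', hw', hww'⟩
  · exact hz.2 (hZU hwZ)
  · exact hw' (Subtype.ext hww' ▸ hwZ)

/-- **Sierpiński's theorem**: a continuum covered by countably many closed sets, any two of which
are equal or disjoint, lies in one of them. Otherwise, a decreasing sequence of continua none of
which lies in a member of the cover can be made to miss every member. -/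
theorem exists_subset_of_countable_closed_cover {X : Type*} [TopologicalSpace X] [T4Space X]
    {C : Set X} (hC : IsCompact C) (hconn : IsPreconnected C) {F : ℕ → Set X}
    (hF : ∀ n, IsClosed (F n)) (hdisj : ∀ m n, F m = F n ∨ Disjoint (F m) (F n))
    (hcover : C ⊆ ⋃ n, F n) : ∃ n, C ⊆ F n := by
  by_contra! hnot
  let Q := {D : Set X // D ⊆ C ∧ IsCompact D ∧ IsPreconnected D ∧ ∀ n, ¬ D ⊆ F n}
  have step (D : Q) (k : ℕ) : ∃ D' : Q, D'.1 ⊆ D.1 ∧ Disjoint D'.1 (F k) := by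
    obtain ⟨D, hDC, hDc, hDp, hDn⟩ := D
    obtain ⟨z, hzD, hzk⟩ := Set.not_subset.1 (hDn k)
    obtain ⟨j, hzj⟩ := Set.mem_iUnion.1 (hcover (hDC hzD))
    have hjk : Disjoint (F j) (F k) :=
      (hdisj j k).resolve_left fun h ↦ hzk (h ▸ hzj)
    obtain ⟨U, hUo, hjU, hUk⟩ := normal_exists_closure_subset (hF j) (hF k).isOpen_compl
      hjk.subset_compl_right
    by_cases hDU : D ⊆ U
    · exact ⟨⟨D, hDC, hDc, hDp, hDn⟩, subset_rfl,
        Set.disjoint_left.2 fun y hy ↦ hUk (subset_closure (hDU hy))⟩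
    · obtain ⟨K, hKs, hKc, hKp, hzK, hKU⟩ :=
        exists_subcontinuum_not_subset hDc hDp hUo hDU hzD (hjU hzj)
      refine ⟨⟨K, fun y hy ↦ hDC (hKs hy).1, hKc, hKp, fun n hn ↦ ?_⟩,
        fun y hy ↦ (hKs hy).1, Set.disjoint_left.2 fun y hy ↦ hUk (hKs hy).2⟩
      rcases hdisj n j with h | h
      · exact hKU ((h ▸ hn).trans hjU)
      · exact Set.disjoint_left.1 h (hn hzK) hzj
  choose next hnext_sub hnext_disj using step
  let seq : ℕ → Q := fun n ↦
    Nat.rec ⟨C, subset_rfl, hC, hconn, hnot⟩ (fun k D ↦ next D k) n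
  have hne (n : ℕ) : (seq n).1.Nonempty := by
    obtain ⟨x, hx, -⟩ := Set.not_subset.1 ((seq n).2.2.2.2 0)
    exact ⟨x, hx⟩
  obtain ⟨x, hx⟩ := IsCompact.nonempty_iInter_of_sequence_nonempty_isCompact_isClosed
    (fun n ↦ (seq n).1) (fun n ↦ hnext_sub (seq n) n) hne (seq 0).2.2.1
    (fun n ↦ (seq n).2.2.1.isClosed)
  rw [Set.mem_iInter] at hx
  obtain ⟨k, hk⟩ := Set.mem_iUnion.1 (hcover (hx 0))
  exact Set.disjoint_left.1 (hnext_disj (seq k) k) (hx (k + 1)) hk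

/-! ### Complementary components with disjoint closures -/

/-- If `x` lies in the closures of the components of `p` and of `q` in the complement of `K`, then
no subset of `K` avoiding `x` separates `p` and `q`. -/
lemma connectedComponentIn_compl_eq_of_mem_closure {X : Type*} [TopologicalSpace X]
    {K S : Set X} (hSK : S ⊆ K) {p q x : X} (hp : p ∉ K) (hq : q ∉ K) (hxS : x ∉ S)
    (hxp : x ∈ closure (connectedComponentIn Kᶜ p))
    (hxq : x ∈ closure (connectedComponentIn Kᶜ q)) :
    connectedComponentIn Sᶜ p = connectedComponentIn Sᶜ q := by
  have key {r : X} (hr : r ∉ K) (hxr : x ∈ closure (connectedComponentIn Kᶜ r)) :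
      x ∈ connectedComponentIn Sᶜ r := by
    have hpre : IsPreconnected (insert x (connectedComponentIn Kᶜ r)) :=
      isPreconnected_connectedComponentIn.subset_closure (Set.subset_insert _ _)
        (Set.insert_subset hxr subset_closure)
    refine hpre.subset_connectedComponentIn (.inr (mem_connectedComponentIn hr)) ?_
      (Set.mem_insert _ _)
    exact Set.insert_subset hxS
      ((connectedComponentIn_subset _ _).trans (Set.compl_subset_compl.2 hSK))
  rw [connectedComponentIn_eq (key hp hxp), connectedComponentIn_eq (key hq hxq)]

/-- If the components of the complement of `K` have pairwise disjoint closures, then a continuum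
that meets two of them meets `K` in an uncountable set: otherwise these closures and countably many
singletons contradict Sierpiński's theorem. -/
theorem not_countable_inter_of_disjoint_closure {X : Type*} [TopologicalSpace X] [T4Space X]
    [TopologicalSpace.SeparableSpace X] [LocallyConnectedSpace X] {K C : Set X} (hK : IsClosed K)
    (hdisj : ∀ x y, x ∉ K → y ∉ K → connectedComponentIn Kᶜ x ≠ connectedComponentIn Kᶜ y →
      Disjoint (closure (connectedComponentIn Kᶜ x)) (closure (connectedComponentIn Kᶜ y)))
    (hC : IsCompact C) (hconn : IsPreconnected C) {p q : X} (hpC : p ∈ C) (hqC : q ∈ C)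
    (hp : p ∉ K) (hq : q ∉ K)
    (hpq : connectedComponentIn Kᶜ p ≠ connectedComponentIn Kᶜ q) : ¬ (C ∩ K).Countable := by
  intro hcount
  let comps : Set (Set X) := connectedComponentIn Kᶜ '' Kᶜ
  have hcomps : comps.Countable := by
    refine Set.PairwiseDisjoint.countable_of_isOpen (s := id) ?_ ?_ ?_
    · rintro _ ⟨x, hx, rfl⟩ _ ⟨y, hy, rfl⟩ hne
      exact (hdisj x y hx hy hne).mono subset_closure subset_closure
    · rintro _ ⟨x, hx, rfl⟩
      exact hK.isOpen_compl.connectedComponentIn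
    · rintro _ ⟨x, hx, rfl⟩
      exact ⟨x, mem_connectedComponentIn hx⟩
  let rest : Set X := {a ∈ C ∩ K | ∀ x ∉ K, a ∉ closure (connectedComponentIn Kᶜ x)}
  have hrest : rest.Countable := hcount.mono fun a ha ↦ ha.1
  have hfam : (closure '' comps ∪ (fun a ↦ {a}) '' rest).Countable :=
    (hcomps.image _).union (hrest.image _)
  obtain ⟨F, hF⟩ := hfam.exists_eq_range ⟨_, .inl ⟨_, ⟨p, hp, rfl⟩, rfl⟩⟩
  have hmem (n : ℕ) : (∃ x ∉ K, F n = closure (connectedComponentIn Kᶜ x)) ∨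
      ∃ a ∈ rest, F n = {a} := by
    have : F n ∈ closure '' comps ∪ (fun a ↦ {a}) '' rest := hF ▸ Set.mem_range_self n
    rcases this with ⟨_, ⟨x, hx, rfl⟩, h⟩ | ⟨a, ha, h⟩
    · exact .inl ⟨x, hx, h.symm⟩
    · exact .inr ⟨a, ha, h.symm⟩
  have hcover : C ⊆ ⋃ n, F n := by
    rw [← Set.sUnion_range, ← hF]
    intro y hy
    by_cases hcl : ∃ x ∉ K, y ∈ closure (connectedComponentIn Kᶜ x)
    · obtain ⟨x, hx, hyx⟩ := hcl
      exact ⟨_, .inl ⟨_, ⟨x, hx, rfl⟩, rfl⟩, hyx⟩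
    · push Not at hcl
      have hyK : y ∈ K := by
        by_contra hyK
        exact hcl y hyK (subset_closure (mem_connectedComponentIn hyK))
      exact ⟨{y}, .inr ⟨y, ⟨⟨hy, hyK⟩, hcl⟩, rfl⟩, rfl⟩
  obtain ⟨n, hn⟩ := exists_subset_of_countable_closed_cover hC hconn (F := F)
    (fun n ↦ by
      rcases hmem n with ⟨x, -, h⟩ | ⟨a, -, h⟩ <;> rw [h]
      · exact isClosed_closure
      · exact isClosed_singleton)
    (fun m n ↦ by
      rcases hmem m with ⟨x, hx, h⟩ | ⟨a, ha, h⟩ <;> rcases hmem n with ⟨y, hy, h'⟩ | ⟨b, hb, h'⟩ <;>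
        rw [h, h']
      · by_cases hxy : connectedComponentIn Kᶜ x = connectedComponentIn Kᶜ y
        · exact .inl (by rw [hxy])
        · exact .inr (hdisj x y hx hy hxy)
      · exact .inr (Set.disjoint_singleton_right.2 (hb.2 x hx))
      · exact .inr (Set.disjoint_singleton_left.2 (ha.2 y hy))
      · by_cases hab : a = b
        · exact .inl (by rw [hab])
        · exact .inr (Set.disjoint_singleton.2 hab))
    hcover
  rcases hmem n with ⟨x, hx, h⟩ | ⟨a, ha, h⟩
  · have key {r : X} (hr : r ∉ K) (hrC : r ∈ C) :
        connectedComponentIn Kᶜ r = connectedComponentIn Kᶜ x := by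
      by_contra hne
      exact Set.disjoint_left.1 (hdisj r x hr hx hne)
        (subset_closure (mem_connectedComponentIn hr)) (h ▸ hn hrC)
    exact hpq ((key hp hpC).trans (key hq hqC).symm)
  · have : p = a := by simpa [h] using hn hpC
    exact hp (this ▸ ha.1.2)

/-! ### Concatenating linked paths -/

/-- If each of the paths `σ 0, …, σ m` meets the next one, then some curve runs through pieces of
them in turn, the piece of `σ k` during the time interval `[k, k + 1]`. -/
lemma exists_continuous_chain {X : Type*} [TopologicalSpace X] {σ : ℕ → unitInterval → X}
    (hσ : ∀ k, Continuous (σ k)) (m : ℕ) (hlink : ∀ k < m, ∃ s t, σ k s = σ (k + 1) t)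
    (e : unitInterval) :
    ∃ g : ℝ → X, Continuous g ∧ g (m + 1) = σ m e ∧
      ∀ x : ℝ, 0 ≤ x → x ≤ m + 1 → ∃ k ≤ m, (k : ℝ) ≤ x ∧ x ≤ k + 1 ∧ g x ∈ Set.range (σ k) := by
  induction m generalizing e with
  | zero =>
    refine ⟨fun _ ↦ σ 0 e, continuous_const, rfl, fun x h0 h1 ↦
      ⟨0, le_rfl, by simpa using h0, by simpa using h1, e, rfl⟩⟩
  | succ m ih =>
    obtain ⟨s, t, hst⟩ := hlink m m.lt_succ_self
    obtain ⟨g, hg, hgs, hgr⟩ := ih (fun k hk ↦ hlink k (hk.trans m.lt_succ_self)) s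
    have : PathConnectedSpace unitInterval := isPathConnected_iff_pathConnectedSpace.1 <|
      (convex_Icc (0 : ℝ) 1).isPathConnected ⟨0, by simp⟩
    let γ : Path t e := PathConnectedSpace.somePath t e
    refine ⟨fun x ↦ if x ≤ m + 1 then g x else σ (m + 1) (γ.extend (x - (m + 1))), ?_, ?_, ?_⟩
    · refine Continuous.if_le hg ((hσ _).comp (γ.continuous_extend.comp (by fun_prop)))
        continuous_id continuous_const fun x hx ↦ ?_
      simp [hx, hgs, hst]
    · have : ¬ ((m : ℝ) + 1 + 1 ≤ m + 1) := by linarith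
      simp [this]
    · intro x h0 h1
      by_cases hx : x ≤ m + 1
      · obtain ⟨k, hk, h⟩ := hgr x h0 hx
        exact ⟨k, hk.trans m.le_succ, by simpa [hx] using h⟩
      · refine ⟨m + 1, le_rfl, ?_, ?_, γ.extend (x - (m + 1)), by simp [hx]⟩
        · push_cast
          linarith
        · exact_mod_cast h1

/-! ### Cross-shaped paths on three disjoint grids -/

/-- The nearest point to `x` in the set `h * (ℤ + i / 3)`. -/
noncomputable def gridCoord (h : ℝ) (i : Fin 3) (x : ℝ) : ℝ :=
  h * (round (x / h - i / 3) + i / 3)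

lemma abs_gridCoord_sub_le {h : ℝ} (hh : 0 < h) (i : Fin 3) (x : ℝ) :
    |gridCoord h i x - x| ≤ h / 2 := by
  have h1 := abs_sub_round (x / h - i / 3)
  have h2 : gridCoord h i x - x =
      -(h * (x / h - i / 3 - round (x / h - i / 3))) := by
    rw [gridCoord]
    field_simp
    ring
  rw [h2, abs_neg, abs_mul, abs_of_pos hh]
  nlinarith

/-- The path that runs through the horizontal bar of a cross with arms of length `4 * h` during
`[0, 1/2]` and through its vertical bar during `[1/2, 1]`. The centre of the cross is the vertex
next to `c` of the grid of the lines on which some coordinate lies in `h * (ℤ + i / 3)`. -/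
noncomputable def crossPath (h : ℝ) (i : Fin 3) (c : Plane) (u : unitInterval) : Plane :=
  !₂[gridCoord h i (c 0) - 4 * h * Real.sin (min (3 * Real.pi * (u - 1 / 2)) 0),
    gridCoord h i (c 1) - 4 * h * Real.sin (max (3 * Real.pi * (u - 1 / 2)) 0)]

lemma crossPath_zero (h : ℝ) (i : Fin 3) (c : Plane) (u : unitInterval) :
    crossPath h i c u 0 =
      gridCoord h i (c 0) - 4 * h * Real.sin (min (3 * Real.pi * (u - 1 / 2)) 0) := by
  simp [crossPath]

lemma crossPath_one (h : ℝ) (i : Fin 3) (c : Plane) (u : unitInterval) :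
    crossPath h i c u 1 =
      gridCoord h i (c 1) - 4 * h * Real.sin (max (3 * Real.pi * (u - 1 / 2)) 0) := by
  simp [crossPath]

lemma continuous_crossPath (h : ℝ) (i : Fin 3) (c : Plane) : Continuous (crossPath h i c) := by
  unfold crossPath
  fun_prop

lemma abs_crossPath_sub_le {h : ℝ} (hh : 0 < h) (i : Fin 3) (c : Plane) (u : unitInterval)
    (j : Fin 2) : |crossPath h i c u j - c j| ≤ 9 / 2 * h := by
  have key (x y : ℝ) : |gridCoord h i x - 4 * h * Real.sin y - x| ≤ 9 / 2 * h := by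
    have h1 := abs_le.1 (abs_gridCoord_sub_le hh i x)
    have h2 := Real.sin_le_one y
    have h3 := Real.neg_one_le_sin y
    rw [abs_le]
    constructor <;> nlinarith
  fin_cases j
  · exact crossPath_zero h i c u ▸ key (c 0) _
  · exact crossPath_one h i c u ▸ key (c 1) _

lemma exists_crossPath_eq_gridCoord (h : ℝ) (i : Fin 3) (c : Plane) (u : unitInterval) :
    ∃ j, crossPath h i c u j = gridCoord h i (c j) := by
  rcases le_total (3 * Real.pi * ((u : ℝ) - 1 / 2)) 0 with hu | hu
  · exact ⟨1, by rw [crossPath_one, max_eq_right hu]; simp⟩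
  · exact ⟨0, by rw [crossPath_zero, min_eq_right hu]; simp⟩

/-- Slight perturbations of the cross-shaped paths at two nearby points meet: the horizontal bar of
the first cross crosses the vertical bar of the second. -/
lemma exists_eq_of_near_crossPath {h : ℝ} (hh : 0 < h) (i : Fin 3) {c c' : Plane}
    (hc : ∀ j, |c j - c' j| ≤ h) {σ τ : unitInterval → Plane}
    (hσ : Continuous σ) (hτ : Continuous τ)
    (hσc : ∀ u j, |σ u j - crossPath h i c u j| ≤ h / 10)
    (hτc : ∀ u j, |τ u j - crossPath h i c' u j| ≤ h / 10) : ∃ s t, σ s = τ t := by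
  let A : unitInterval → unitInterval := fun u ↦ ⟨u / 3, by
    have := u.2.1
    have := u.2.2
    constructor <;> linarith⟩
  let B : unitInterval → unitInterval := fun u ↦ ⟨2 / 3 + u / 3, by
    have := u.2.1
    have := u.2.2
    constructor <;> linarith⟩
  have hpi := Real.pi_pos
  have hA0 (u) : (σ (A u)) 1 ≤ gridCoord h i (c 1) + h / 10 ∧
      gridCoord h i (c 1) - h / 10 ≤ (σ (A u)) 1 := by
    have h1 := abs_le.1 (hσc (A u) 1)
    have h2 : 3 * Real.pi * ((A u : ℝ) - 1 / 2) ≤ 0 := by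
      have : (A u : ℝ) = u / 3 := rfl
      rw [this]
      have := u.2.2
      nlinarith
    rw [crossPath_one, max_eq_right h2, Real.sin_zero] at h1
    constructor <;> linarith
  have hB0 (u) : (τ (B u)) 0 ≤ gridCoord h i (c' 0) + h / 10 ∧
      gridCoord h i (c' 0) - h / 10 ≤ (τ (B u)) 0 := by
    have h1 := abs_le.1 (hτc (B u) 0)
    have h2 : 0 ≤ 3 * Real.pi * ((B u : ℝ) - 1 / 2) := by
      have : (B u : ℝ) = 2 / 3 + u / 3 := rfl
      rw [this]
      have := u.2.1
      apply mul_nonneg <;> linarith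
    rw [crossPath_zero, min_eq_right h2, Real.sin_zero] at h1
    constructor <;> linarith
  have hs1 : Real.sin (3 * Real.pi / 2) = -1 := by
    rw [show 3 * Real.pi / 2 = Real.pi / 2 + Real.pi by ring, Real.sin_add_pi,
      Real.sin_pi_div_two]
  have hAl : (σ (A 0)) 0 ≤ gridCoord h i (c 0) - 4 * h + h / 10 := by
    have h1 := abs_le.1 (hσc (A 0) 0)
    have h2 : 3 * Real.pi * ((A 0 : ℝ) - 1 / 2) = -(3 * Real.pi / 2) := by
      simp [A]
      ring
    rw [crossPath_zero, h2, min_eq_left (by linarith), Real.sin_neg, hs1] at h1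
    linarith
  have hAr : gridCoord h i (c 0) + 4 * h - h / 10 ≤ (σ (A 1)) 0 := by
    have h1 := abs_le.1 (hσc (A 1) 0)
    have h2 : 3 * Real.pi * ((A 1 : ℝ) - 1 / 2) = -(Real.pi / 2) := by
      simp [A]
      ring
    rw [crossPath_zero, h2, min_eq_left (by linarith), Real.sin_neg, Real.sin_pi_div_two] at h1
    linarith
  have hBd : (τ (B 0)) 1 ≤ gridCoord h i (c' 1) - 4 * h + h / 10 := by
    have h1 := abs_le.1 (hτc (B 0) 1)
    have h2 : 3 * Real.pi * ((B 0 : ℝ) - 1 / 2) = Real.pi / 2 := by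
      simp [B]
      ring
    rw [crossPath_one, h2, max_eq_left (by linarith), Real.sin_pi_div_two] at h1
    linarith
  have hBu : gridCoord h i (c' 1) + 4 * h - h / 10 ≤ (τ (B 1)) 1 := by
    have h1 := abs_le.1 (hτc (B 1) 1)
    have h2 : 3 * Real.pi * ((B 1 : ℝ) - 1 / 2) = 3 * Real.pi / 2 := by
      simp [B]
      ring
    rw [crossPath_one, h2, max_eq_left (by linarith), hs1] at h1
    linarith
  have g0 := abs_le.1 (abs_gridCoord_sub_le hh i (c 0))
  have g1 := abs_le.1 (abs_gridCoord_sub_le hh i (c 1))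
  have g0' := abs_le.1 (abs_gridCoord_sub_le hh i (c' 0))
  have g1' := abs_le.1 (abs_gridCoord_sub_le hh i (c' 1))
  have c0 := abs_le.1 (hc 0)
  have c1 := abs_le.1 (hc 1)
  obtain ⟨s, t, hst⟩ := exists_eq_of_crossing (a := σ ∘ A) (b := τ ∘ B)
    (hσ.comp (by fun_prop)) (hτ.comp (by fun_prop))
    (fun t ↦ by simp only [Function.comp]; linarith [hB0 t])
    (fun t ↦ by simp only [Function.comp]; linarith [hB0 t])
    (fun s ↦ by simp only [Function.comp]; linarith [hA0 s])
    (fun s ↦ by simp only [Function.comp]; linarith [hA0 s])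
  exact ⟨A s, B t, hst⟩

/-- No point is near all three grids: two of them would come near it in the same coordinate. -/
lemma not_forall_near_grid {h : ℝ} (hh : 0 < h) (v : Plane) :
    ¬ ∀ i : Fin 3, ∃ j : Fin 2, ∃ z : ℤ, |v j - h * (z + i / 3)| ≤ h / 10 := by
  intro H
  choose j z hz using H
  obtain ⟨i, i', hne, hj⟩ := Fintype.exists_ne_map_eq_of_card_lt j (by simp)
  have h1 := abs_le.1 (hz i)
  have h2 := abs_le.1 (hz i')
  rw [hj] at h1
  have h3 : (3 * z i + i : ℤ) ≠ 3 * z i' + i' := by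
    intro h
    apply hne
    ext
    omega
  rcases lt_or_gt_of_ne h3 with h4 | h4
  · have h5 : (3 * z i + i + 1 : ℤ) ≤ 3 * z i' + i' := h4
    have h6 : (3 * z i + (i : ℕ) + 1 : ℝ) ≤ 3 * z i' + (i' : ℕ) := by exact_mod_cast h5
    nlinarith
  · have h5 : (3 * z i' + i' + 1 : ℤ) ≤ 3 * z i + i := h4
    have h6 : (3 * z i' + (i' : ℕ) + 1 : ℝ) ≤ 3 * z i + (i : ℕ) := by exact_mod_cast h5
    nlinarith

/-! ### Three curves without a common point -/

lemma norm_le_two_mul_of_abs_le {v : Plane} {r : ℝ} (h : ∀ j, |v j| ≤ r) : ‖v‖ ≤ 2 * r := by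
  have hr : 0 ≤ r := (abs_nonneg _).trans (h 0)
  rw [EuclideanSpace.norm_eq, Fin.sum_univ_two]
  refine Real.sqrt_le_iff.2 ⟨by positivity, ?_⟩
  have h0 := pow_le_pow_left₀ (abs_nonneg _) (h 0) 2
  have h1 := pow_le_pow_left₀ (abs_nonneg _) (h 1) 2
  simp only [Real.norm_eq_abs]
  nlinarith

lemma abs_sub_le_dist (v w : Plane) (j : Fin 2) : |v j - w j| ≤ dist v w := by
  rw [dist_eq_norm]
  exact PiLp.norm_apply_le (v - w) j

/-- The time `k + (i + u / 2) / 3`, with the interval `[0, m + 1]` of all times rescaled to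
`[0, 1]`. Each unit interval thus has three disjoint subintervals, one for each `i`. -/
noncomputable def slot (m k : ℕ) (i : Fin 3) (u : unitInterval) : unitInterval :=
  Set.projIcc 0 1 zero_le_one ((k + ((i : ℕ) + (u : ℝ) / 2) / 3) / (m + 1))

lemma continuous_slot (m k : ℕ) (i : Fin 3) : Continuous (slot m k i) :=
  continuous_projIcc.comp (by fun_prop)

lemma coe_slot {m k : ℕ} (hk : k ≤ m) (i : Fin 3) (u : unitInterval) :
    (slot m k i u : ℝ) = (k + ((i : ℕ) + (u : ℝ) / 2) / 3) / (m + 1) := by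
  have hk' : (k : ℝ) ≤ m := by exact_mod_cast hk
  have hi : ((i : ℕ) : ℝ) ≤ 2 := by exact_mod_cast Nat.le_of_lt_succ i.2
  have := u.2.1
  have := u.2.2
  rw [slot, Set.projIcc_of_mem]
  constructor
  · positivity
  · rw [div_le_one (by positivity)]
    linarith

/-- The slots are pairwise disjoint, closed intervals. -/
lemma isClosedEmbedding_slot (m : ℕ) :
    Topology.IsClosedEmbedding fun z : (Fin (m + 1) × Fin 3) × unitInterval ↦
      slot m z.1.1 z.1.2 z.2 := by
  refine Continuous.isClosedEmbedding ?_ ?_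
  · exact continuous_prod_of_discrete_left.2 fun x ↦ continuous_slot m x.1 x.2
  · rintro ⟨⟨k, i⟩, u⟩ ⟨⟨k', i'⟩, u'⟩ h
    have h1 := congrArg Subtype.val h
    simp only at h1
    rw [coe_slot (Nat.le_of_lt_succ k.2), coe_slot (Nat.le_of_lt_succ k'.2),
      div_left_inj' (by positivity)] at h1
    have := u.2.1
    have := u.2.2
    have := u'.2.1
    have := u'.2.2
    have h2 : 3 * (k : ℕ) + (i : ℕ) < 3 * (k' : ℕ) + (i' : ℕ) + 1 := by
      exact_mod_cast (by linarith :
        3 * ((k : ℕ) : ℝ) + ((i : ℕ) : ℝ) < 3 * ((k' : ℕ) : ℝ) + ((i' : ℕ) : ℝ) + 1)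
    have h3 : 3 * (k' : ℕ) + (i' : ℕ) < 3 * (k : ℕ) + (i : ℕ) + 1 := by
      exact_mod_cast (by linarith :
        3 * ((k' : ℕ) : ℝ) + ((i' : ℕ) : ℝ) < 3 * ((k : ℕ) : ℝ) + ((i : ℕ) : ℝ) + 1)
    have hk : k = k' := Fin.ext (by omega)
    have hi : i = i' := Fin.ext (by omega)
    subst hk hi
    have hu : u = u' := Subtype.ext (by linarith)
    rw [hu]

/-- Paths prescribed on the slots, within distance `r` of the given curve, extend to a curve within
distance `r` of it, by Tietze's theorem for the closed ball. -/
lemma exists_near_eq_on_slots (f₀ : PlaneCurve) (m : ℕ) {T : ℕ → Fin 3 → unitInterval → Plane}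
    (hT : ∀ k i, Continuous (T k i)) {r : ℝ} (hr : 0 < r)
    (hclose : ∀ k ≤ m, ∀ i u, ‖T k i u - f₀ (slot m k i u)‖ ≤ r) :
    ∃ f₁ : PlaneCurve, dist f₁ f₀ ≤ r ∧ ∀ k ≤ m, ∀ i u, f₁ (slot m k i u) = T k i u := by
  have hE := isClosedEmbedding_slot m
  let D : C((Fin (m + 1) × Fin 3) × unitInterval, Plane) :=
    ⟨fun z ↦ T z.1.1 z.1.2 z.2 - f₀ (slot m z.1.1 z.1.2 z.2), by
      refine Continuous.sub ?_ (f₀.continuous.comp hE.continuous)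
      exact continuous_prod_of_discrete_left.2 fun x ↦ hT x.1 x.2⟩
  have hD (z) : D z ∈ Metric.closedBall (0 : Plane) r :=
    mem_closedBall_zero_iff.2 (hclose _ (Nat.le_of_lt_succ z.1.1.2) _ _)
  have := Metric.instTietzeExtensionClosedBall.{0, 0} ℝ (0 : Plane) hr
  obtain ⟨G, hG, hGD⟩ := D.exists_extension_forall_mem hE hD
  refine ⟨f₀ + G, (ContinuousMap.dist_le hr.le).2 fun x ↦ ?_, fun k hk i u ↦ ?_⟩
  · rw [dist_eq_norm, ContinuousMap.add_apply, add_sub_cancel_left]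
    exact mem_closedBall_zero_iff.1 (hG x)
  · have hz (z) : G (slot m z.1.1 z.1.2 z.2) = D z := DFunLike.congr_fun hGD z
    have h1 : G (slot m k i u) = T k i u - f₀ (slot m k i u) :=
      hz ((⟨k, Nat.lt_succ_of_le hk⟩, i), u)
    rw [ContinuousMap.add_apply, h1, add_sub_cancel]

/-- Near every curve there is a curve all of whose slight perturbations `f₂` contain the ranges of
three curves near the given one that have no common point. It runs, in the `i`-th slot of the
`k`-th time interval, through a cross near the given curve in the `i`-th of three grids. For each
`i`, consecutive crosses meet even after a perturbation, so that one curve runs through all of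
them. -/
theorem exists_near_forall_near_exists_three_curves (f₀ : PlaneCurve) {ε : ℝ} (hε : 0 < ε) :
    ∃ f₁ : PlaneCurve, dist f₁ f₀ < ε ∧ ∃ δ > 0, ∀ f₂ : PlaneCurve, dist f₂ f₁ < δ →
      ∃ g : Fin 3 → PlaneCurve,
        (∀ i, dist (g i) f₀ < ε ∧ Set.range (g i) ⊆ Set.range f₂) ∧
          ∀ x, ∃ i, x ∉ Set.range (g i) := by
  obtain ⟨h, hh, hhε⟩ : ∃ h > 0, 20 * h = ε := ⟨ε / 20, by positivity, by ring⟩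
  obtain ⟨η, hη, hηh⟩ := Metric.uniformContinuous_iff.1
    (CompactSpace.uniformContinuous_of_continuous f₀.continuous) h hh
  obtain ⟨m, hm⟩ := exists_nat_one_div_lt hη
  have hm0 : (0 : ℝ) < m + 1 := by positivity
  -- the given curve, with the time rescaled to `[0, m + 1]`
  let Φ : ℝ → Plane := fun y ↦ f₀ (Set.projIcc 0 1 zero_le_one (y / (m + 1)))
  have hΦ {y y' : ℝ} (hy : |y - y'| ≤ 1) (j) : |Φ y j - Φ y' j| ≤ h := by
    refine (abs_sub_le_dist _ _ j).trans (hηh ?_).le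
    refine lt_of_le_of_lt ((LipschitzWith.projIcc (zero_le_one' ℝ)).dist_le_mul _ _) ?_
    rw [NNReal.coe_one, one_mul, Real.dist_eq, ← sub_div, abs_div, abs_of_pos hm0]
    exact (div_le_div_of_nonneg_right hy hm0.le).trans_lt hm
  have hΦx (x : unitInterval) : f₀ x = Φ (x * (m + 1)) := by
    simp only [Φ]
    rw [mul_div_cancel_right₀ _ hm0.ne', Set.projIcc_val]
  obtain ⟨f₁, hf₁, hf₁c⟩ := exists_near_eq_on_slots f₀ m
    (T := fun k i ↦ crossPath h i (Φ k)) (fun k i ↦ continuous_crossPath _ _ _)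
    (by positivity : 0 < 2 * (6 * h)) fun k hk i u ↦ by
      refine norm_le_two_mul_of_abs_le fun j ↦ ?_
      have h1 := abs_le.1 (abs_crossPath_sub_le hh i (Φ k) u j)
      have hi : ((i : ℕ) : ℝ) ≤ 2 := by exact_mod_cast Nat.le_of_lt_succ i.2
      have hu0 := u.2.1
      have hu1 := u.2.2
      have h3 := abs_le.1 (hΦ (y := k) (y' := k + ((i : ℕ) + (u : ℝ) / 2) / 3) (by
        rw [sub_add_cancel_left, abs_neg, abs_of_nonneg (by positivity)]
        linarith) j)
      rw [PiLp.sub_apply, hΦx, coe_slot hk, div_mul_cancel₀ _ hm0.ne', abs_le]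
      constructor <;> linarith
  refine ⟨f₁, hf₁.trans_lt (by linarith), h / 10, by positivity, fun f₂ hf₂ ↦ ?_⟩
  let σ : Fin 3 → ℕ → unitInterval → Plane := fun i k u ↦ f₂ (slot m k i u)
  have hσc (i k) : Continuous (σ i k) := f₂.continuous.comp (continuous_slot m k i)
  have hσ (i) {k} (hk : k ≤ m) (u) (j) :
      |σ i k u j - crossPath h i (Φ k) u j| ≤ h / 10 := by
    rw [← hf₁c k hk i u]
    exact (abs_sub_le_dist _ _ j).trans ((ContinuousMap.dist_apply_le_dist _).trans hf₂.le)
  have hg (i : Fin 3) : ∃ g : PlaneCurve, ∀ x : unitInterval,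
      ∃ k ≤ m, (k : ℝ) ≤ (x : ℝ) * (m + 1) ∧ (x : ℝ) * (m + 1) ≤ k + 1 ∧ g x ∈ Set.range (σ i k) := by
    obtain ⟨g, hgc, -, hg⟩ := exists_continuous_chain (hσc i) m (fun k hk ↦
      exists_eq_of_near_crossPath hh i (hΦ (by simp)) (hσc i k) (hσc i (k + 1))
        (hσ i hk.le) (hσ i hk)) 0
    refine ⟨⟨fun x ↦ g ((x : ℝ) * (m + 1)), by fun_prop⟩, fun x ↦ hg _ ?_ ?_⟩
    · exact mul_nonneg x.2.1 hm0.le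
    · exact mul_le_of_le_one_left hm0.le x.2.2
  choose g hg using hg
  refine ⟨g, fun i ↦ ⟨?_, ?_⟩, fun v ↦ ?_⟩
  · rw [ContinuousMap.dist_lt_iff hε]
    intro x
    obtain ⟨k, hk, hkx, hxk, u, hu⟩ := hg i x
    rw [dist_eq_norm]
    refine (norm_le_two_mul_of_abs_le (r := 6 * h) fun j ↦ ?_).trans_lt (by linarith)
    have h1 := abs_le.1 (hσ i hk u j)
    have h2 := abs_le.1 (abs_crossPath_sub_le hh i (Φ k) u j)
    have h3 := abs_le.1 (hΦ (y := k) (y' := x * (m + 1)) (by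
      rw [abs_le]
      constructor <;> linarith) j)
    rw [PiLp.sub_apply, ← hu, hΦx x, abs_le]
    constructor <;> linarith
  · rintro _ ⟨x, rfl⟩
    obtain ⟨k, -, -, -, u, hu⟩ := hg i x
    exact ⟨_, hu⟩
  · by_contra! hv
    refine not_forall_near_grid hh v fun i ↦ ?_
    obtain ⟨x, rfl⟩ := hv i
    obtain ⟨k, hk, -, -, u, hu⟩ := hg i x
    obtain ⟨j, hj⟩ := exists_crossPath_eq_gridCoord h i (Φ k) u
    have := hσ i hk u j
    rw [hj, hu] at this
    exact ⟨j, _, this⟩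

/-! ### The generic curve -/

/-- For a fixed pair of points, the set of curves that do not separate them by complementary
components with a common boundary point contains a dense open set. If some curve near a given one
misses `p` and `q` without separating them, then the same path joins `p` and `q` off every curve
close to it. If there is no such curve, then each of the three curves without a common point in the
range of a perturbed curve separates `p` and `q`. -/
theorem eventually_residual_disjoint_closure (p q : Plane) :
    ∀ᶠ f : PlaneCurve in residual PlaneCurve, p ∉ Set.range f → q ∉ Set.range f →
      connectedComponentIn (Set.range f)ᶜ p ≠ connectedComponentIn (Set.range f)ᶜ q →
        Disjoint (closure (connectedComponentIn (Set.range f)ᶜ p))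
          (closure (connectedComponentIn (Set.range f)ᶜ q)) := by
  set W := {f : PlaneCurve | p ∉ Set.range f → q ∉ Set.range f →
      connectedComponentIn (Set.range f)ᶜ p ≠ connectedComponentIn (Set.range f)ᶜ q →
        Disjoint (closure (connectedComponentIn (Set.range f)ᶜ p))
          (closure (connectedComponentIn (Set.range f)ᶜ q))} with hW
  suffices Dense (interior W) from
    Filter.mem_of_superset (residual_of_dense_open isOpen_interior this) interior_subset
  refine Metric.dense_iff.2 fun f₀ ε hε ↦ ?_
  by_cases hex : ∃ f₁ ∈ Metric.ball f₀ ε, p ∉ Set.range f₁ ∧ q ∉ Set.range f₁ ∧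
      connectedComponentIn (Set.range f₁)ᶜ p = connectedComponentIn (Set.range f₁)ᶜ q
  · obtain ⟨f₁, hf₁, hp, hq, heq⟩ := hex
    refine ⟨f₁, hf₁, mem_interior_iff_mem_nhds.2 ?_⟩
    have hopen : IsOpen (Set.range f₁)ᶜ := (isCompact_range f₁.continuous).isClosed.isOpen_compl
    have hpath : IsPathConnected (connectedComponentIn (Set.range f₁)ᶜ p) :=
      hopen.connectedComponentIn.isConnected_iff_isPathConnected.1
        (isConnected_connectedComponentIn_iff.2 hp)
    obtain ⟨γ, hγ⟩ := hpath.joinedIn p (mem_connectedComponentIn hp) q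
      (heq ▸ mem_connectedComponentIn hq)
    have hγc : IsCompact (Set.range γ) := isCompact_range γ.continuous
    have hmaps : ∀ᶠ f : PlaneCurve in nhds f₁, Set.MapsTo f Set.univ (Set.range γ)ᶜ := by
      refine ContinuousMap.eventually_mapsTo isCompact_univ hγc.isClosed.isOpen_compl ?_
      rintro x - ⟨u, hu⟩
      exact connectedComponentIn_subset _ _ (hγ u) ⟨x, hu.symm⟩
    filter_upwards [hmaps] with f hf _ _ hne
    refine absurd ?_ hne
    have hsub : Set.range γ ⊆ (Set.range f)ᶜ := by
      rintro _ hy ⟨x, rfl⟩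
      exact hf (Set.mem_univ x) hy
    exact connectedComponentIn_eq <| (isPreconnected_range γ.continuous).subset_connectedComponentIn
      ⟨0, γ.source⟩ hsub ⟨1, γ.target⟩
  · push Not at hex
    obtain ⟨f₁, hf₁, δ, hδ, H⟩ := exists_near_forall_near_exists_three_curves f₀ hε
    refine ⟨f₁, hf₁, mem_interior_iff_mem_nhds.2 ?_⟩
    filter_upwards [Metric.ball_mem_nhds f₁ hδ] with f hf hp hq _
    obtain ⟨g, hg, hempty⟩ := H f hf
    refine Set.disjoint_left.2 fun x hxp hxq ↦ ?_
    obtain ⟨i, hi⟩ := hempty x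
    exact hex (g i) (hg i).1 (fun h ↦ hp ((hg i).2 h)) (fun h ↦ hq ((hg i).2 h))
      (connectedComponentIn_compl_eq_of_mem_closure (hg i).2 hp hq hi hxp hxq)

lemma mk_eq_continuum_of_not_countable {s : Set Plane} (hs : IsClosed s) (hc : ¬ s.Countable) :
    Cardinal.mk s = Cardinal.continuum := by
  apply le_antisymm
  · refine (Cardinal.mk_set_le s).trans ?_
    rw [(WithLp.equiv 2 (Fin 2 → ℝ)).cardinal_eq]
    simp only [Cardinal.mk_pi, Cardinal.mk_real, Cardinal.prod_const, Cardinal.mk_fin,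
      Cardinal.lift_id, Nat.cast_ofNat]
    exact (Cardinal.power_le_power_left Cardinal.continuum_ne_zero
      (Cardinal.ofNat_lt_aleph0 (n := 2)).le).trans Cardinal.continuum_power_aleph0.le
  · obtain ⟨F, hFs, -, hF⟩ := hs.exists_nat_bool_injection_of_not_countable hc
    have h1 := Cardinal.mk_le_of_injective
      (f := fun b ↦ (⟨F b, hFs ⟨b, rfl⟩⟩ : s)) fun b c hbc ↦ hF (Subtype.ext_iff.1 hbc)
    simpa using h1

theorem theoremt :
    ∀ᶠ f : PlaneCurve in residual PlaneCurve,
      ∀ p q : Plane, p ∉ Set.range f → q ∉ Set.range f →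
        SeparatesInPlane (Set.range f) p q →
          ∀ C : Set Plane, IsPlaneContinuum C → p ∈ C → q ∈ C →
            Cardinal.mk ↥(C ∩ Set.range f) = Cardinal.continuum := by
  obtain ⟨S, hSc, hSd⟩ := TopologicalSpace.exists_countable_dense Plane
  have hgen := (eventually_countable_ball hSc).2 fun p _ ↦ (eventually_countable_ball hSc).2
    fun q _ ↦ eventually_residual_disjoint_closure p q
  filter_upwards [hgen] with f hf p q hp hq hsep C hC hpC hqC
  have hK : IsClosed (Set.range f) := (isCompact_range f.continuous).isClosed
  refine mk_eq_continuum_of_not_countable (hC.1.isClosed.inter hK) ?_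
  refine not_countable_inter_of_disjoint_closure hK (fun x y hx hy hxy ↦ ?_) hC.1
    hC.2.isPreconnected hpC hqC hp hq hsep.2.2
  -- the open components of `x` and `y` contain points of the countable dense set
  have key {z : Plane} (hz : z ∉ Set.range f) :
      ∃ r ∈ S, r ∉ Set.range f ∧
        connectedComponentIn (Set.range f)ᶜ z = connectedComponentIn (Set.range f)ᶜ r := by
    obtain ⟨r, hr, hrS⟩ := hSd.inter_open_nonempty _ hK.isOpen_compl.connectedComponentIn
      ⟨z, mem_connectedComponentIn hz⟩
    exact ⟨r, hrS, connectedComponentIn_subset _ _ hr, connectedComponentIn_eq hr⟩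
  obtain ⟨r, hrS, hr, hxr⟩ := key hx
  obtain ⟨s, hsS, hs, hys⟩ := key hy
  rw [hxr, hys] at hxy ⊢
  exact hf r hrS s hsS hr hs hxy
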